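/- Let $X$ be an infinite-dimensional separable (real or complex) Banach space with dual $X^*$, and let $\mathbf{CK}(X^*)$ be the set of all nonempty convex weak$^*$-compact subsets of $X^*$, endowed with the weak$^*$-Hausdorff hypertopology, i.e. the topology induced by the family of pseudometrics $$d_H^{(A)}(K,L)=\max\Big\{\max_{\sigma\in K}\min_{\tau\in L}|(\sigma-\tau)(A)|,\ \max_{\tau\in L}\min_{\sigma\in K}|(\sigma-\tau)(A)|\Big\},\qquad A\in X,\ K,L\in\mathbf{CK}(X^*)$$ (so a net $(K_j)$ converges to $K$ if and only if $d_H^{(A)}(K_j,K)\to 0$ for every $A\in X$). Then the set $$\mathcal D=\{K\in\mathbf{CK}(X^*) : K \text{ is the weak}^*\text{-closure of the set } \mathcal E(K) \text{ of its extreme points}\}$$ is a dense $G_\delta$ subset of $\mathbf{CK}(X^*)$. -/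

import Mathlib

open scoped ENNReal

/-- Multiplication of functionals by real numbers, taken from Mathlib's real module structure on
`WeakDual 𝕜 X`; the name only fixes which of two definitionally equal instances is found first. -/
noncomputable instance (priority := high) weakDualRealSMul (𝕜 X : Type*) [RCLike 𝕜]
    [NormedAddCommGroup X] [NormedSpace 𝕜 X] : SMul ℝ (WeakDual 𝕜 X) :=
  (WeakDual.instModule' (𝕜 := 𝕜) (E := X) ℝ).toSMul

theorem weakDual_real_smul_apply {𝕜 X : Type*} [RCLike 𝕜] [NormedAddCommGroup X]
    [NormedSpace 𝕜 X] (r : ℝ) (σ : WeakDual 𝕜 X) (A : X) : (r • σ) A = (r : 𝕜) * σ A :=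
  RCLike.real_smul_eq_coe_mul r (σ A)

/-- The hyperspace `CK(X*)` of all nonempty convex weak*-compact subsets of the dual `X*` of a
(real or complex) normed space `X`. The type `WeakDual 𝕜 X` is `X*` with its weak* topology. -/
structure ConvexWeakStarCompacts (𝕜 X : Type*) [RCLike 𝕜] [NormedAddCommGroup X]
    [NormedSpace 𝕜 X] where
  /-- The underlying set of functionals. -/
  carrier : Set (WeakDual 𝕜 X)
  nonempty : carrier.Nonempty
  convex : Convex ℝ carrier
  isCompact : IsCompact carrier

namespace ConvexWeakStarCompacts

variable {𝕜 X : Type*} [RCLike 𝕜] [NormedAddCommGroup X] [NormedSpace 𝕜 X]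

/-- The Hausdorff pseudometric `d_H^{(A)}` attached to `A ∈ X`. It is written with values in
`[0, ∞]`; on nonempty weak*-compact sets it is finite and the suprema and infima are attained. -/
noncomputable def hausdorffDistAt (A : X) (K L : ConvexWeakStarCompacts 𝕜 X) : ℝ≥0∞ :=
  max (⨆ σ ∈ K.carrier, ⨅ τ ∈ L.carrier, ‖(σ - τ) A‖ₑ)
    (⨆ τ ∈ L.carrier, ⨅ σ ∈ K.carrier, ‖(σ - τ) A‖ₑ)

/-- `d_H^{(A)}(K, L)` is the Hausdorff distance in `𝕜` of the images of `K` and `L` under the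
evaluation at `A`. -/
theorem hausdorffDistAt_eq (A : X) (K L : ConvexWeakStarCompacts 𝕜 X) :
    hausdorffDistAt A K L = Metric.hausdorffEDist ((fun σ : WeakDual 𝕜 X => σ A) '' K.carrier)
      ((fun σ : WeakDual 𝕜 X => σ A) '' L.carrier) := by
  have h1 : ∀ σ τ : WeakDual 𝕜 X, ‖(σ - τ) A‖ₑ = edist (σ A) (τ A) := fun σ τ => by
    rw [edist_eq_enorm_sub]; rfl
  have h2 : ∀ σ τ : WeakDual 𝕜 X, ‖(σ - τ) A‖ₑ = edist (τ A) (σ A) := fun σ τ => by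
    rw [h1, edist_comm]
  rw [hausdorffDistAt, Metric.hausdorffEDist_def, iSup_image, iSup_image]
  simp only [Metric.infEDist, iInf_image]
  congr 1
  · simp only [h1]
  · simp only [h2]

/-- The pseudometric space structure on `CK(X*)` given by `d_H^{(A)}`. -/
@[reducible] noncomputable def pseudoEMetricAt (𝕜 : Type*) {X : Type*} [RCLike 𝕜]
    [NormedAddCommGroup X] [NormedSpace 𝕜 X] (A : X) :
    PseudoEMetricSpace (ConvexWeakStarCompacts 𝕜 X) where
  edist := hausdorffDistAt A
  edist_self K := by
    rw [hausdorffDistAt_eq, Metric.hausdorffEDist_self]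
  edist_comm K L := by
    rw [hausdorffDistAt_eq, hausdorffDistAt_eq, Metric.hausdorffEDist_comm]
  edist_triangle K L M := by
    simp only [hausdorffDistAt_eq]
    exact Metric.hausdorffEDist_triangle

/-- The weak*-Hausdorff hypertopology on `CK(X*)`: the topology induced by the family of
pseudometrics `d_H^{(A)}`, `A ∈ X`, i.e. the coarsest topology finer than each of the
pseudometric topologies. -/
noncomputable instance weakStarHausdorffTopology :
    TopologicalSpace (ConvexWeakStarCompacts 𝕜 X) :=
  ⨅ A : X, (pseudoEMetricAt 𝕜 A).toUniformSpace.toTopologicalSpace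

/-- The set `𝒟` of all `K ∈ CK(X*)` whose set of extreme points is weak*-dense in `K`. -/
def denseExtreme (𝕜 X : Type*) [RCLike 𝕜] [NormedAddCommGroup X] [NormedSpace 𝕜 X] :
    Set (ConvexWeakStarCompacts 𝕜 X) :=
  {K | K.carrier = closure (K.carrier.extremePoints ℝ)}

end ConvexWeakStarCompacts

/-! `G_δ`: by uniform boundedness each `K` lies in a dual ball, and separability makes dual balls
metrizable. Failure of density of the extreme points is therefore detected by countably many pairs:
a compact set that `K` meets, inside an open set `U` free of extreme points of `K`. Missing a
compact set is an open condition on `K` by Hahn–Banach. Having an extreme point in `U` is open among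
subsets of a fixed ball: by Choquet's lemma an extreme point in `U` has a slice of `K` around it
inside `U`; a nearby `L` has a nonempty slice inside `U` too, and the functional defining the slice
attains its maximum over `L` at an extreme point.

Density: a basic neighbourhood sees only finitely many evaluations. Enlarge `K` to the set `L` of
all functionals having on these vectors the joint values of some element of `K`, and lying in a
large sublevel set `normSqAdd e ≤ C`. Strict convexity makes every point of `L` at level `C`
extreme. In infinite dimension each weak* neighbourhood of a point of `L` contains a line along
which finitely many evaluations are constant, and that line reaches level `C`. -/

open Set Filter Topology TopologicalSpace

/-! ### Extreme points and countable separation in compact sets -/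

/-- **Choquet's lemma**, first half: if `x` is an extreme point of a compact convex set `K` and `U`
is a neighbourhood of `x`, then `K \ U` is contained in a compact convex subset of `K` which does
not contain `x`. -/
theorem exists_isCompact_convex_notMem_of_mem_extremePoints {E : Type*} [AddCommGroup E]
    [Module ℝ E] [TopologicalSpace E] [IsTopologicalAddGroup E] [ContinuousSMul ℝ E]
    [LocallyConvexSpace ℝ E] [T2Space E] {K U : Set E} {x : E} (hK : IsCompact K)
    (hKc : Convex ℝ K) (hx : x ∈ K.extremePoints ℝ) (hU : IsOpen U) (hxU : x ∈ U) :
    ∃ M ⊆ K, IsCompact M ∧ Convex ℝ M ∧ K \ U ⊆ M ∧ x ∉ M := by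
  -- Only finitely many local pieces are needed by compactness; extremality of `x` keeps it out of
  -- the convex join of two pieces.
  refine (hK.diff hU).induction_on
    (p := fun s => ∃ M ⊆ K, IsCompact M ∧ Convex ℝ M ∧ s ⊆ M ∧ x ∉ M) ?_ ?_ ?_ ?_
  · exact ⟨∅, empty_subset _, isCompact_empty, convex_empty, Subset.rfl, notMem_empty x⟩
  · rintro s t hst ⟨M, hMK, hM, hMc, htM, hxM⟩
    exact ⟨M, hMK, hM, hMc, hst.trans htM, hxM⟩
  · rintro s t ⟨M, hMK, hM, hMc, hsM, hxM⟩ ⟨N, hNK, hN, hNc, htN, hxN⟩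
    rcases M.eq_empty_or_nonempty with rfl | hM0
    · exact ⟨N, hNK, hN, hNc, union_subset (hsM.trans (empty_subset _)) htN, hxN⟩
    rcases N.eq_empty_or_nonempty with rfl | hN0
    · exact ⟨M, hMK, hM, hMc, union_subset hsM (htN.trans (empty_subset _)), hxM⟩
    refine ⟨convexJoin ℝ M N, convexJoin_subset hMK hNK hKc, ?_, hMc.convexJoin hNc,
      union_subset (hsM.trans (subset_convexJoin_left hN0))
        (htN.trans (subset_convexJoin_right hM0)), ?_⟩
    · have him : convexJoin ℝ M N =
          (fun p : (E × E) × ℝ => AffineMap.lineMap p.1.1 p.1.2 p.2) '' ((M ×ˢ N) ×ˢ Icc 0 1) := by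
        ext z
        simp only [mem_convexJoin, segment_eq_image_lineMap, mem_image, Prod.exists, mem_prod]
        constructor
        · rintro ⟨a, ha, b, hb, t, ht, rfl⟩
          exact ⟨a, b, t, ⟨⟨ha, hb⟩, ht⟩, rfl⟩
        · rintro ⟨a, b, t, ⟨⟨ha, hb⟩, ht⟩, rfl⟩
          exact ⟨a, ha, b, hb, t, ht, rfl⟩
      rw [him]
      refine ((hM.prod hN).prod isCompact_Icc).image ?_
      simp only [AffineMap.lineMap_apply_module]
      fun_prop
    · rintro hxj
      obtain ⟨a, ha, b, hb, hxab⟩ := mem_convexJoin.1 hxj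
      rcases (mem_extremePoints_iff_forall_segment.1 hx).2 a (hMK ha) b (hNK hb) hxab with rfl | rfl
      exacts [hxM ha, hxN hb]
  · intro y hy
    have hyx : y ∈ ({x}ᶜ : Set E) := by
      rintro rfl
      exact hy.2 hxU
    obtain ⟨s, ⟨hs, hsc⟩, hsx⟩ := (closed_nhds_basis y).mem_iff.1 (isOpen_compl_singleton.mem_nhds hyx)
    obtain ⟨c, ⟨hc, hcc⟩, hcs⟩ := (LocallyConvexSpace.convex_basis (𝕜 := ℝ) y).mem_iff.1 hs
    refine ⟨c ∩ (K \ U), inter_mem (mem_nhdsWithin_of_mem_nhds hc) self_mem_nhdsWithin,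
      K ∩ closure c, inter_subset_left, hK.inter_right isClosed_closure, hKc.inter hcc.closure,
      fun z hz => ⟨hz.2.1, subset_closure hz.1⟩, fun h => ?_⟩
    exact hsx (closure_minimal hcs hsc h.2) rfl

/-- In a compact metrizable subset `B` of a Hausdorff space, points and neighbourhoods are separated
by countably many pairs consisting of a compact set and an open set containing it. -/
theorem exists_countable_isCompact_isOpen_pairs {E : Type*} [TopologicalSpace E]
    {B : Set E} (hB : IsCompact B) [MetrizableSpace B] :
    ∃ S : Set (Set E × Set E), S.Countable ∧
      (∀ p ∈ S, IsCompact p.1 ∧ IsOpen p.2 ∧ p.1 ⊆ p.2) ∧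
      ∀ x ∈ B, ∀ O, IsOpen O → x ∈ O → ∃ p ∈ S, x ∈ p.1 ∧ p.2 ∩ B ⊆ O := by
  have : CompactSpace B := isCompact_iff_compactSpace.1 hB
  let _ := metrizableSpaceMetric B
  have : SecondCountableTopology B := inferInstance
  -- Extends relatively open sets to open sets of `E`; the value `∅` at a non-open `V` is never
  -- used.
  have hex : ∀ V : Set B, ∃ U : Set E, IsOpen V → IsOpen U ∧ Subtype.val ⁻¹' U = V := by
    intro V
    by_cases hV : IsOpen V
    · obtain ⟨U, hU, hUV⟩ := isOpen_induced_iff.1 hV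
      exact ⟨U, fun _ => ⟨hU, hUV⟩⟩
    · exact ⟨∅, fun h => absurd h hV⟩
  choose U hU using hex
  have hb := isBasis_countableBasis B
  refine ⟨(fun q : Set B × Set B => (Subtype.val '' closure q.1, U q.2)) ''
    ({q ∈ countableBasis B ×ˢ countableBasis B | closure q.1 ⊆ q.2}), ?_, ?_, ?_⟩
  · exact ((((countable_countableBasis B).prod (countable_countableBasis B))).mono
      (sep_subset _ _)).image _
  · rintro _ ⟨q, ⟨hq, hqc⟩, rfl⟩
    obtain ⟨h1, h2⟩ := hU q.2 (hb.isOpen hq.2)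
    refine ⟨isClosed_closure.isCompact.image continuous_subtype_val, h1, ?_⟩
    rintro _ ⟨y, hy, rfl⟩
    exact h2.ge (hqc hy)
  · intro x hx O hO hxO
    obtain ⟨W, hW, hxW, hWO⟩ := hb.exists_subset_of_mem_open (a := (⟨x, hx⟩ : B)) hxO
      (hO.preimage continuous_subtype_val)
    obtain ⟨V, hV, hxV, hVW⟩ := hb.exists_closure_subset ((hb.isOpen hW).mem_nhds hxW)
    refine ⟨_, ⟨(V, W), ⟨⟨hV, hW⟩, hVW⟩, rfl⟩, ⟨_, subset_closure hxV, rfl⟩, ?_⟩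
    rintro y ⟨hyU, hyB⟩
    have : (⟨y, hyB⟩ : B) ∈ W := (hU W (hb.isOpen hW)).2.le hyU
    exact hWO this

/-! ### Duality and separation in the weak* topology -/

namespace WeakDual

variable {𝕜 X : Type*} [RCLike 𝕜] [NormedAddCommGroup X] [NormedSpace 𝕜 X]

instance instLocallyConvexSpaceReal : LocallyConvexSpace ℝ (WeakDual 𝕜 X) :=
  WeakBilin.locallyConvexSpace (B := topDualPairing 𝕜 X)

/-- Every weak*-continuous functional on the dual is an evaluation. -/
theorem exists_eq_eval (f : StrongDual 𝕜 (WeakDual 𝕜 X)) : ∃ A : X, ∀ σ, f σ = σ A := by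
  obtain ⟨A, hA⟩ := LinearMap.dualEmbedding_surjective (topDualPairing 𝕜 X) f
  exact ⟨A, fun σ => by rw [← hA]; rfl⟩

/-- Strict separation of a point from a weak*-closed convex set by an evaluation. -/
theorem exists_re_eval_lt {M : Set (WeakDual 𝕜 X)} (hM : Convex ℝ M) (hMc : IsClosed M)
    {σ : WeakDual 𝕜 X} (hσ : σ ∉ M) :
    ∃ (A : X) (u : ℝ), (∀ τ ∈ M, RCLike.re (τ A) < u) ∧ u < RCLike.re (σ A) := by
  obtain ⟨f, u, h1, h2⟩ := RCLike.geometric_hahn_banach_point_closed (𝕜 := 𝕜) hM hMc hσ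
  -- The sign puts `σ` on the upper side, so that slices are sets where the real part is large.
  obtain ⟨A, hA⟩ := exists_eq_eval (-f)
  have hA' : ∀ τ : WeakDual 𝕜 X, RCLike.re (τ A) = - RCLike.re (f τ) := fun τ => by
    rw [← hA, _root_.neg_apply, map_neg]
  refine ⟨A, -u, fun τ hτ => ?_, ?_⟩
  · rw [hA']; exact neg_lt_neg (h2 τ hτ)
  · rw [hA']; exact neg_lt_neg h1

/-- The real part of the evaluation at `A`, as a weak*-continuous real functional. -/
noncomputable def reEval (A : X) : StrongDual ℝ (WeakDual 𝕜 X) where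
  toFun σ := RCLike.re (σ A)
  map_add' σ τ := map_add RCLike.re (σ A) (τ A)
  map_smul' r σ := by
    change RCLike.re ((r • σ) A) = _
    rw [weakDual_real_smul_apply]; simp
  cont := RCLike.continuous_re.comp (eval_continuous A)

@[simp] theorem reEval_apply (A : X) (σ : WeakDual 𝕜 X) : reEval A σ = RCLike.re (σ A) := rfl

/-- **Krein–Milman lemma** for faces: the real part of an evaluation attains its maximum over a
nonempty weak*-compact set at an extreme point. -/
theorem exists_mem_extremePoints_isMaxOn {K : Set (WeakDual 𝕜 X)} (hK : IsCompact K)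
    (hK0 : K.Nonempty) (A : X) :
    ∃ σ ∈ K.extremePoints ℝ, ∀ τ ∈ K, RCLike.re (τ A) ≤ RCLike.re (σ A) := by
  have hexp := ContinuousLinearMap.toExposed.isExposed (l := reEval A) (A := K)
  obtain ⟨z, hz, hmax⟩ := hK.exists_isMaxOn hK0 (reEval (𝕜 := 𝕜) A).continuous.continuousOn
  obtain ⟨σ, hσ⟩ := (hexp.isCompact hK).extremePoints_nonempty ⟨z, hz, hmax⟩
  exact ⟨σ, hexp.isExtreme.extremePoints_subset_extremePoints hσ, hσ.1.2⟩

/-- Compactness gives pointwise bounds; completeness of `X` makes them uniform, by Banach–Steinhaus.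
-/
theorem isBounded_of_isCompact [CompleteSpace X] {K : Set (WeakDual 𝕜 X)} (hK : IsCompact K) :
    Bornology.IsBounded K :=
  isBounded_iff_isVonNBounded.2 (hK.isVonNBounded 𝕜)

end WeakDual

/-! ### The hypertopology and the `G_δ` property -/

namespace ConvexWeakStarCompacts

variable {𝕜 X : Type*} [RCLike 𝕜] [NormedAddCommGroup X] [NormedSpace 𝕜 X]

/-- The compact set of values `σ A`, `σ ∈ K`. -/
def evalImage (A : X) (K : ConvexWeakStarCompacts 𝕜 X) : NonemptyCompacts 𝕜 where
  carrier := (fun σ : WeakDual 𝕜 X => σ A) '' K.carrier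
  isCompact' := K.isCompact.image (WeakDual.eval_continuous A)
  nonempty' := K.nonempty.image _

theorem continuous_evalImage (A : X) : Continuous (evalImage (𝕜 := 𝕜) A) := by
  refine continuous_iInf_dom (i := A) ?_
  let _ := pseudoEMetricAt 𝕜 A
  refine Isometry.continuous (fun K L => ?_)
  exact (hausdorffDistAt_eq A K L).symm

/-- This set and its existential counterpart are pulled back from the Vietoris topology on compact
sets of scalars. All later openness claims rest on these two. -/
theorem isOpen_forall_eval_mem (A : X) {V : Set 𝕜} (hV : IsOpen V) :
    IsOpen {K : ConvexWeakStarCompacts 𝕜 X | ∀ σ ∈ K.carrier, σ A ∈ V} := by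
  convert! (NonemptyCompacts.isOpen_subsets_of_isOpen hV).preimage (continuous_evalImage A) using 1
  ext K
  exact image_subset_iff.symm

theorem isOpen_exists_eval_mem (A : X) {V : Set 𝕜} (hV : IsOpen V) :
    IsOpen {K : ConvexWeakStarCompacts 𝕜 X | ∃ σ ∈ K.carrier, σ A ∈ V} := by
  convert! (NonemptyCompacts.isOpen_inter_nonempty_of_isOpen hV).preimage
    (continuous_evalImage A) using 1
  ext K
  exact (image_inter_nonempty_iff).symm

/-- The dual ball of radius `r`, as a subset of the weak dual. -/
def dualBall (𝕜 X : Type*) [RCLike 𝕜] [NormedAddCommGroup X] [NormedSpace 𝕜 X] (r : ℝ) :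
    Set (WeakDual 𝕜 X) :=
  WeakDual.toStrongDual ⁻¹' Metric.closedBall 0 r

theorem isCompact_dualBall (r : ℝ) : IsCompact (dualBall 𝕜 X r) :=
  WeakDual.isCompact_closedBall 0 r

theorem mem_dualBall_iff {r : ℝ} (hr : 0 ≤ r) {σ : WeakDual 𝕜 X} :
    σ ∈ dualBall 𝕜 X r ↔ ∀ A, ‖σ A‖ ≤ r * ‖A‖ := by
  rw [dualBall, mem_preimage, mem_closedBall_zero_iff, ContinuousLinearMap.opNorm_le_iff hr]
  rfl

theorem isClosed_subset_dualBall {r : ℝ} (hr : 0 ≤ r) :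
    IsClosed {K : ConvexWeakStarCompacts 𝕜 X | K.carrier ⊆ dualBall 𝕜 X r} := by
  have : {K : ConvexWeakStarCompacts 𝕜 X | K.carrier ⊆ dualBall 𝕜 X r} =
      ⋂ A : X, {K | ∃ σ ∈ K.carrier, σ A ∈ {z : 𝕜 | r * ‖A‖ < ‖z‖}}ᶜ := by
    ext K
    simp only [mem_ofPred_eq, mem_iInter, mem_compl_iff, not_exists, not_and, not_lt, subset_def,
      mem_dualBall_iff hr]
    exact ⟨fun h A σ hσ => h σ hσ A, fun h σ hσ A => h A σ hσ⟩
  rw [this]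
  exact isClosed_iInter fun A =>
    (isOpen_exists_eval_mem A (isOpen_lt continuous_const continuous_norm)).isClosed_compl

theorem exists_subset_dualBall [CompleteSpace X] (K : ConvexWeakStarCompacts 𝕜 X) :
    ∃ r, K.carrier ⊆ dualBall 𝕜 X r :=
  (WeakDual.isBounded_toWeakDual_preimage_iff_isBounded.2
    (WeakDual.isBounded_of_isCompact K.isCompact)).subset_closedBall (0 : StrongDual 𝕜 X)

/-- The sets disjoint from a given weak*-compact set form an open subset of the hyperspace. -/
theorem isOpen_disjoint {C : Set (WeakDual 𝕜 X)} (hC : IsCompact C) :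
    IsOpen {K : ConvexWeakStarCompacts 𝕜 X | Disjoint K.carrier C} := by
  rw [isOpen_iff_mem_nhds]
  intro K hK
  change ∀ᶠ L in 𝓝 K, Disjoint L.carrier C
  refine hC.induction_on (p := fun s => ∀ᶠ L in 𝓝 K, Disjoint L.carrier s) ?_ ?_ ?_ ?_
  · simp
  · exact fun s t hst h => h.mono fun L hL => hL.mono_right hst
  · exact fun s t hs ht => (hs.and ht).mono fun L hL => disjoint_union_right.2 hL
  · intro σ hσ
    obtain ⟨A, u, h1, h2⟩ := WeakDual.exists_re_eval_lt K.convex K.isCompact.isClosed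
      (disjoint_right.1 hK hσ)
    refine ⟨{τ | u < RCLike.re (τ A)}, mem_nhdsWithin_of_mem_nhds (IsOpen.mem_nhds
      (isOpen_lt continuous_const (RCLike.continuous_re.comp (WeakDual.eval_continuous A))) h2), ?_⟩
    filter_upwards [(isOpen_forall_eval_mem A (isOpen_lt RCLike.continuous_re
      continuous_const)).mem_nhds h1] with L hL
    exact disjoint_left.2 fun τ hτ h => lt_asymm (hL τ hτ) h

/-- Among the sets contained in a fixed dual ball, those without an extreme point in a given
weak*-open set form a closed subset of the hyperspace. -/
theorem isClosed_disjoint_extremePoints {r : ℝ} (hr : 0 ≤ r) {U : Set (WeakDual 𝕜 X)}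
    (hU : IsOpen U) :
    IsClosed {K : ConvexWeakStarCompacts 𝕜 X |
      K.carrier ⊆ dualBall 𝕜 X r ∧ Disjoint (K.carrier.extremePoints ℝ) U} := by
  rw [← isOpen_compl_iff, isOpen_iff_mem_nhds]
  intro K hK
  by_cases hKr : K.carrier ⊆ dualBall 𝕜 X r
  · obtain ⟨σ, hσ, hσU⟩ := not_disjoint_iff.1 fun h => hK ⟨hKr, h⟩
    obtain ⟨M, hMK, hM, hMc, hKM, hσM⟩ :=
      exists_isCompact_convex_notMem_of_mem_extremePoints K.isCompact K.convex hσ hU hσU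
    obtain ⟨A, u, h1, h2⟩ := WeakDual.exists_re_eval_lt hMc hM.isClosed hσM
    have hcl : IsClosed {τ : WeakDual 𝕜 X | u ≤ RCLike.re (τ A)} :=
      isClosed_le continuous_const (RCLike.continuous_re.comp (WeakDual.eval_continuous A))
    -- This is the part of the slice outside `U`, compact thanks to the ball. A nearby `L` misses it
    -- but still enters the slice, so a maximizing extreme point of `L` must lie in `U`.
    have hC : IsCompact ((dualBall 𝕜 X r ∩ {τ | u ≤ RCLike.re (τ A)}) \ U) :=
      ((isCompact_dualBall r).inter_right hcl).diff hU
    have hKC : Disjoint K.carrier ((dualBall 𝕜 X r ∩ {τ | u ≤ RCLike.re (τ A)}) \ U) :=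
      disjoint_left.2 fun τ hτ h => (h1 τ (hKM ⟨hτ, h.2⟩)).not_ge h.1.2
    filter_upwards [(isOpen_disjoint hC).mem_nhds hKC, (isOpen_exists_eval_mem A (isOpen_lt
      continuous_const RCLike.continuous_re)).mem_nhds ⟨σ, extremePoints_subset hσ, h2⟩]
      with L hL ⟨τ, hτ, hτu⟩ ⟨hLr, hLU⟩
    obtain ⟨ρ, hρ, hmax⟩ := WeakDual.exists_mem_extremePoints_isMaxOn L.isCompact L.nonempty A
    have hρL := extremePoints_subset hρ
    exact disjoint_left.1 hL hρL ⟨⟨hLr hρL, (le_of_lt hτu).trans (hmax τ hτ)⟩,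
      disjoint_left.1 hLU hρ⟩
  · filter_upwards [(isClosed_subset_dualBall hr).isOpen_compl.mem_nhds hKr] with L hL h
    exact hL h.1

theorem closure_extremePoints_subset (K : ConvexWeakStarCompacts 𝕜 X) :
    closure (K.carrier.extremePoints ℝ) ⊆ K.carrier :=
  closure_minimal extremePoints_subset K.isCompact.isClosed

theorem isGδ_denseExtreme [CompleteSpace X] [SeparableSpace X] : IsGδ (denseExtreme 𝕜 X) := by
  have hpairs (n : ℕ) := by
    have := WeakDual.metrizable_of_isCompact 𝕜 X _ (isCompact_dualBall (𝕜 := 𝕜) (X := X) n)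
    exact exists_countable_isCompact_isOpen_pairs (isCompact_dualBall (𝕜 := 𝕜) (X := X) n)
  choose S hSc hS hSsep using hpairs
  -- For `n` too small to contain `K` the second alternative holds automatically.
  have : denseExtreme 𝕜 X = ⋂ n : ℕ, ⋂ p ∈ S n, ({K | Disjoint K.carrier p.1} ∪
      {K | K.carrier ⊆ dualBall 𝕜 X n ∧ Disjoint (K.carrier.extremePoints ℝ) p.2}ᶜ) := by
    ext K
    simp only [mem_iInter]
    constructor
    · intro hK n p hp
      by_contra h
      simp only [mem_union, mem_compl_iff, not_or, not_not] at h
      obtain ⟨σ, hσK, hσp⟩ := not_disjoint_iff.1 h.1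
      have hσ : σ ∈ closure (K.carrier.extremePoints ℝ) := by rwa [← hK]
      obtain ⟨τ, hτU, hτ⟩ := mem_closure_iff.1 hσ _ (hS n p hp).2.1 ((hS n p hp).2.2 hσp)
      exact disjoint_left.1 h.2.2 hτ hτU
    · intro h
      refine Subset.antisymm (fun σ hσ => ?_) K.closure_extremePoints_subset
      by_contra hcl
      obtain ⟨r, hr⟩ := K.exists_subset_dualBall
      obtain ⟨n, hn⟩ := exists_nat_ge r
      have hKn : K.carrier ⊆ dualBall 𝕜 X n :=
        hr.trans (preimage_mono (Metric.closedBall_subset_closedBall hn))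
      obtain ⟨p, hp, hσp, hpO⟩ := hSsep n σ (hKn hσ) _ isClosed_closure.isOpen_compl hcl
      rcases h n p hp with h | h
      · exact disjoint_left.1 h hσ hσp
      · refine h ⟨hKn, disjoint_left.2 fun τ hτ hτp => ?_⟩
        exact hpO ⟨hτp, hKn (extremePoints_subset hτ)⟩ (subset_closure hτ)
  rw [this]
  exact .iInter fun n => .biInter (hSc n) fun p hp => IsOpen.isGδ <|
    (isOpen_disjoint (hS n p hp).1).union
      (isClosed_disjoint_extremePoints n.cast_nonneg (hS n p hp).2.1).isOpen_compl

/-- Two sets with the same images under the evaluations at finitely many points are close. -/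
theorem dense_of_forall_finset {D : Set (ConvexWeakStarCompacts 𝕜 X)}
    (h : ∀ (K : ConvexWeakStarCompacts 𝕜 X) (s : Finset X), ∃ L ∈ D, ∀ A ∈ s,
      (fun σ : WeakDual 𝕜 X => σ A) '' L.carrier = (fun σ : WeakDual 𝕜 X => σ A) '' K.carrier) :
    Dense D := by
  intro K
  rw [mem_closure_iff_nhds]
  intro t ht
  rw [nhds_iInf, mem_iInf] at ht
  obtain ⟨I, hI, V, hV, rfl⟩ := ht
  obtain ⟨L, hLD, hL⟩ := h K hI.toFinset
  refine ⟨L, mem_iInter.2 fun i => ?_, hLD⟩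
  let _ := pseudoEMetricAt 𝕜 (i : X)
  obtain ⟨ε, hε, hεV⟩ := EMetric.mem_nhds_iff.1 (hV i)
  refine hεV ?_
  change hausdorffDistAt (i : X) L K < ε
  rw [hausdorffDistAt_eq, hL i (hI.mem_toFinset.2 i.2), Metric.hausdorffEDist_self]
  exact hε

end ConvexWeakStarCompacts

/-! ### A strictly convex function on the dual -/

/-- A separable normed space contains a square-summable sequence which separates functionals. -/
theorem exists_summable_norm_sq_separating (𝕜 X : Type*) [RCLike 𝕜] [NormedAddCommGroup X]
    [NormedSpace 𝕜 X] [SeparableSpace X] :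
    ∃ e : ℕ → X, Summable (fun k => ‖e k‖ ^ 2) ∧
      ∀ σ τ : WeakDual 𝕜 X, (∀ k, σ (e k) = τ (e k)) → σ = τ := by
  -- These weights give `‖e k‖ ≤ 2⁻ᵏ`; the summand `1` avoids division by zero.
  have hc (k : ℕ) : (0 : ℝ) < (1 / 2) ^ k / (1 + ‖denseSeq X k‖) := by positivity
  refine ⟨fun k => (((1 / 2) ^ k / (1 + ‖denseSeq X k‖) : ℝ) : 𝕜) • denseSeq X k, ?_, ?_⟩
  · refine .of_nonneg_of_le (fun k => by positivity) (fun k => ?_)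
      (summable_geometric_of_lt_one (r := (1 / 4 : ℝ)) (by norm_num) (by norm_num))
    rw [norm_smul, RCLike.norm_ofReal, abs_of_pos (hc k)]
    have h1 : (1 / 2 : ℝ) ^ k / (1 + ‖denseSeq X k‖) * ‖denseSeq X k‖ ≤ (1 / 2) ^ k := by
      rw [div_mul_eq_mul_div, div_le_iff₀ (by positivity)]
      exact mul_le_mul_of_nonneg_left (by linarith) (by positivity)
    calc _ ≤ ((1 / 2 : ℝ) ^ k) ^ 2 := by gcongr
      _ = (1 / 4) ^ k := by rw [← pow_mul, mul_comm, pow_mul]; norm_num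
  · intro σ τ h
    refine DFunLike.ext'_iff.2 ((map_continuous σ).ext_on (denseRange_denseSeq X)
      (map_continuous τ) (eqOn_range.2 (funext fun k => ?_)))
    have := h k
    rw [map_smul, map_smul] at this
    exact (smul_right_injective 𝕜 (RCLike.ofReal_ne_zero.2 (hc k).ne')) this

/-- A nonzero functional vanishing at finitely many given points of an infinite-dimensional
space. -/
theorem exists_weakDual_ne_zero_forall_finset {𝕜 X : Type*} [RCLike 𝕜] [NormedAddCommGroup X]
    [NormedSpace 𝕜 X] (hX : ¬ FiniteDimensional 𝕜 X) (s : Finset X) :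
    ∃ ζ : WeakDual 𝕜 X, ζ ≠ 0 ∧ ∀ A ∈ s, ζ A = 0 := by
  let S := Submodule.span 𝕜 (s : Set X)
  have : FiniteDimensional 𝕜 S := FiniteDimensional.span_finset 𝕜 s
  have hcl : IsClosed (S : Set X) := S.closed_of_finiteDimensional
  have hS : S ≠ ⊤ := fun h => hX (Module.finite_def.2 ⟨s, h⟩)
  obtain ⟨x, hx⟩ : ∃ x, x ∉ S := by
    by_contra! h
    exact hS (Submodule.eq_top_iff'.2 h)
  -- Since `S` is closed, the quotient is normed and Hahn–Banach applies to the nonzero class of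
  -- `x`.
  obtain ⟨f, hf⟩ := SeparatingDual.exists_ne_zero (R := 𝕜) (x := S.mkQ x)
    (fun h => hx ((Submodule.Quotient.mk_eq_zero S).1 h))
  refine ⟨StrongDual.toWeakDual (f.comp S.mkQL), fun h => hf ?_, fun A hA => ?_⟩
  · exact DFunLike.congr_fun h x
  · have : S.mkQ A = 0 := (Submodule.Quotient.mk_eq_zero S).2 (Submodule.subset_span hA)
    change f (S.mkQ A) = 0
    rw [this, map_zero]

namespace WeakDual

variable {𝕜 X : Type*} [RCLike 𝕜] [NormedAddCommGroup X] [NormedSpace 𝕜 X] {e : ℕ → X}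

/-- The square of an equivalent dual norm; it is strictly convex when `e` separates functionals. -/
noncomputable def normSqAdd (e : ℕ → X) (σ : WeakDual 𝕜 X) : ℝ :=
  ‖toStrongDual σ‖ ^ 2 + ∑' k, ‖σ (e k)‖ ^ 2

theorem norm_eval_sq_le (σ : WeakDual 𝕜 X) (x : X) :
    ‖σ x‖ ^ 2 ≤ ‖toStrongDual σ‖ ^ 2 * ‖x‖ ^ 2 := by
  rw [← mul_pow]
  exact pow_le_pow_left₀ (norm_nonneg _) ((toStrongDual σ).le_opNorm x) 2

theorem summable_norm_eval_sq (he : Summable fun k => ‖e k‖ ^ 2) (σ : WeakDual 𝕜 X) :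
    Summable fun k => ‖σ (e k)‖ ^ 2 :=
  .of_nonneg_of_le (fun _ => by positivity) (fun k => norm_eval_sq_le σ (e k)) (he.mul_left _)

theorem norm_sq_le_normSqAdd (σ : WeakDual 𝕜 X) : ‖toStrongDual σ‖ ^ 2 ≤ normSqAdd e σ :=
  le_add_of_nonneg_right (tsum_nonneg fun _ => by positivity)

theorem normSqAdd_le (he : Summable fun k => ‖e k‖ ^ 2) (σ : WeakDual 𝕜 X) :
    normSqAdd e σ ≤ ‖toStrongDual σ‖ ^ 2 * (1 + ∑' k, ‖e k‖ ^ 2) := by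
  rw [mul_add, mul_one, ← tsum_mul_left]
  exact add_le_add le_rfl ((summable_norm_eval_sq he σ).tsum_le_tsum
    (fun k => norm_eval_sq_le σ (e k)) (he.mul_left _))

theorem norm_toStrongDual_comb_le {a b : ℝ} (ha : 0 ≤ a) (hb : 0 ≤ b) (σ τ : WeakDual 𝕜 X) :
    ‖toStrongDual (a • σ + b • τ)‖ ≤ a * ‖toStrongDual σ‖ + b * ‖toStrongDual τ‖ := by
  have : toStrongDual (a • σ + b • τ) =
      (a : 𝕜) • toStrongDual σ + (b : 𝕜) • toStrongDual τ := by
    ext x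
    change (a • σ) x + (b • τ) x = _
    rw [weakDual_real_smul_apply, weakDual_real_smul_apply]
    rfl
  rw [this]
  refine (norm_add_le _ _).trans_eq ?_
  rw [norm_smul, norm_smul, RCLike.norm_of_nonneg ha, RCLike.norm_of_nonneg hb]

theorem comb_apply (a b : ℝ) (σ τ : WeakDual 𝕜 X) (x : X) :
    (a • σ + b • τ) x = (a : 𝕜) * σ x + (b : 𝕜) * τ x := by
  change (a • σ) x + (b • τ) x = _
  rw [weakDual_real_smul_apply, weakDual_real_smul_apply]

theorem _root_.RCLike.norm_comb_sq {𝕜 : Type*} [RCLike 𝕜] {a b : ℝ} (hab : a + b = 1) (z w : 𝕜) :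
    ‖(a : 𝕜) * z + (b : 𝕜) * w‖ ^ 2 =
      a * ‖z‖ ^ 2 + b * ‖w‖ ^ 2 - a * b * ‖z - w‖ ^ 2 := by
  simp only [RCLike.norm_sq_eq_def, map_add, map_sub, RCLike.re_ofReal_mul, RCLike.im_ofReal_mul]
  obtain rfl : b = 1 - a := by linarith
  ring

/-- The squared norm is merely convex. Strictness comes from the defect `a * b * ‖z - w‖ ^ 2` at an
index `k` where the two functionals differ. -/
theorem strictConvexOn_normSqAdd (he : Summable fun k => ‖e k‖ ^ 2)
    (hsep : ∀ σ τ : WeakDual 𝕜 X, (∀ k, σ (e k) = τ (e k)) → σ = τ) :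
    StrictConvexOn ℝ univ (normSqAdd (𝕜 := 𝕜) e) := by
  refine ⟨convex_univ, fun σ _ τ _ hne a b ha hb hab => ?_⟩
  obtain ⟨k, hk⟩ : ∃ k, σ (e k) ≠ τ (e k) := by
    by_contra! h
    exact hne (hsep σ τ h)
  have h1 : ‖toStrongDual (a • σ + b • τ)‖ ^ 2 ≤
      a * ‖toStrongDual σ‖ ^ 2 + b * ‖toStrongDual τ‖ ^ 2 :=
    (pow_le_pow_left₀ (norm_nonneg _) (norm_toStrongDual_comb_le ha.le hb.le σ τ) 2).trans
      ((convexOn_pow 2).2 (norm_nonneg (toStrongDual σ)) (norm_nonneg (toStrongDual τ))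
        ha.le hb.le hab)
  have hs := summable_norm_eval_sq he σ
  have ht := summable_norm_eval_sq he τ
  have h2 : ∑' k, ‖(a • σ + b • τ) (e k)‖ ^ 2 <
      ∑' k, (a * ‖σ (e k)‖ ^ 2 + b * ‖τ (e k)‖ ^ 2) := by
    refine Summable.tsum_lt_tsum (i := k) (fun j => ?_) ?_
      (summable_norm_eval_sq he _) ((hs.mul_left a).add (ht.mul_left b))
    · rw [comb_apply, RCLike.norm_comb_sq hab]
      exact sub_le_self _ (by positivity)
    · rw [comb_apply, RCLike.norm_comb_sq hab]
      have : 0 < ‖σ (e k) - τ (e k)‖ := norm_pos_iff.2 (sub_ne_zero.2 hk)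
      exact sub_lt_self _ (by positivity)
  rw [(hs.mul_left a).tsum_add (ht.mul_left b), tsum_mul_left, tsum_mul_left] at h2
  simp only [normSqAdd, smul_eq_mul]
  linarith

theorem lowerSemicontinuous_norm_sq :
    LowerSemicontinuous fun σ : WeakDual 𝕜 X => ‖toStrongDual σ‖ ^ 2 := by
  refine lowerSemicontinuous_iff_isClosed_preimage.2 fun y => ?_
  rcases lt_or_ge y 0 with hy | hy
  · convert! isClosed_empty
    exact eq_empty_of_forall_notMem fun σ hσ => (hy.trans_le (sq_nonneg _)).not_ge hσ
  · convert! isClosed_closedBall (𝕜 := 𝕜) (E := X) 0 (Real.sqrt y) using 1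
    ext σ
    simp only [mem_preimage, mem_Iic, mem_closedBall_zero_iff]
    exact (Real.le_sqrt (norm_nonneg _) hy).symm

/-- The series is the supremum of its finite partial sums, which are weak*-continuous, and the
squared dual norm is weak* lower semicontinuous. -/
theorem isClosed_normSqAdd_le (he : Summable fun k => ‖e k‖ ^ 2) (C : ℝ) :
    IsClosed {σ : WeakDual 𝕜 X | normSqAdd e σ ≤ C} := by
  have : {σ : WeakDual 𝕜 X | normSqAdd e σ ≤ C} = ⋂ s : Finset ℕ,
      (fun σ => ‖toStrongDual σ‖ ^ 2 + ∑ k ∈ s, ‖σ (e k)‖ ^ 2) ⁻¹' Iic C := by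
    ext σ
    simp only [mem_ofPred_eq, mem_iInter, mem_preimage, mem_Iic, normSqAdd]
    constructor
    · exact fun h s => (add_le_add le_rfl ((summable_norm_eval_sq he σ).sum_le_tsum s
        fun _ _ => by positivity)).trans h
    · intro h
      have := (summable_norm_eval_sq he σ).tsum_le_of_sum_le (a₂ := C - ‖toStrongDual σ‖ ^ 2)
        fun s => by linarith [h s]
      linarith
  rw [this]
  refine isClosed_iInter fun s => LowerSemicontinuous.isClosed_preimage
    (lowerSemicontinuous_norm_sq.add (Continuous.lowerSemicontinuous ?_)) C
  exact continuous_finsetSum s fun k _ => (eval_continuous (e k)).norm.pow 2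

/-- On a line with nonzero direction, every value of `normSqAdd e` above a given one is
attained. -/
theorem exists_normSqAdd_add_smul_eq (hconv : ConvexOn ℝ univ (normSqAdd (𝕜 := 𝕜) e))
    {σ ζ : WeakDual 𝕜 X} (hζ : ζ ≠ 0) {C : ℝ} (hσ : normSqAdd e σ ≤ C) :
    ∃ t : ℝ, normSqAdd e (σ + t • ζ) = C := by
  -- Continuity along the line is free: a finite convex function on `ℝ` is continuous.
  have hcont : Continuous fun t : ℝ => normSqAdd e (σ + t • ζ) := by
    have hc : ConvexOn ℝ univ fun t : ℝ => normSqAdd e (σ + t • ζ) := by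
      refine ⟨convex_univ, fun s _ t _ a b ha hb hab => ?_⟩
      have : σ + (a • s + b • t) • ζ = a • (σ + s • ζ) + b • (σ + t • ζ) := by
        obtain rfl : b = 1 - a := by linarith
        simp only [smul_eq_mul]
        module
      simp only [this]
      exact hconv.2 (mem_univ _) (mem_univ _) ha hb hab
    exact continuousOn_univ.1 (hc.continuousOn isOpen_univ)
  have hC : 0 ≤ C := (sq_nonneg _).trans ((norm_sq_le_normSqAdd σ).trans hσ)
  have hζ' : 0 < ‖toStrongDual ζ‖ := norm_pos_iff.2 fun h => hζ (toStrongDual.injective h)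
  -- Chosen to make the norm at `T` at least `C + 1`, whose square exceeds `C`.
  set T : ℝ := (C + 1 + ‖toStrongDual σ‖) / ‖toStrongDual ζ‖
  have hT0 : 0 ≤ T := by positivity
  have hTC : C ≤ normSqAdd e (σ + T • ζ) := by
    have h1 : T * ‖toStrongDual ζ‖ = C + 1 + ‖toStrongDual σ‖ := div_mul_cancel₀ _ hζ'.ne'
    have h2 : toStrongDual (σ + T • ζ) = toStrongDual σ + (T : 𝕜) • toStrongDual ζ := by
      ext x
      change σ x + (T • ζ) x = _
      rw [weakDual_real_smul_apply]
      rfl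
    have h3 : C + 1 ≤ ‖toStrongDual (σ + T • ζ)‖ := by
      have := norm_sub_le (toStrongDual (σ + T • ζ)) (toStrongDual σ)
      rw [h2, add_sub_cancel_left, norm_smul, RCLike.norm_of_nonneg hT0, h1, ← h2] at this
      linarith
    refine le_trans ?_ (norm_sq_le_normSqAdd _)
    nlinarith
  have h0 : σ + (0 : ℝ) • ζ = σ := by module
  obtain ⟨t, -, ht⟩ := intermediate_value_Icc hT0 hcont.continuousOn
    ⟨(congrArg (normSqAdd e) h0).le.trans hσ, hTC⟩
  exact ⟨t, ht⟩

/-- A weak*-neighbourhood is not left along functionals vanishing at suitable finitely many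
points. -/
theorem exists_finset_forall_add_mem {O : Set (WeakDual 𝕜 X)} (hO : IsOpen O) {σ : WeakDual 𝕜 X}
    (hσ : σ ∈ O) : ∃ s : Finset X, ∀ τ : WeakDual 𝕜 X, (∀ A ∈ s, τ A = σ A) → τ ∈ O := by
  obtain ⟨O', hO', rfl⟩ := isOpen_induced_iff.1 hO
  obtain ⟨s, u, hu, hsu⟩ := isOpen_pi_iff.1 hO' _ hσ
  refine ⟨s, fun τ hτ => hsu fun A hA => ?_⟩
  have := (hu A hA).2
  have h : τ A ∈ u A := by rw [hτ A hA]; exact this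
  exact h

end WeakDual

/-! ### Density -/

namespace ConvexWeakStarCompacts

variable {𝕜 X : Type*} [RCLike 𝕜] [NormedAddCommGroup X] [NormedSpace 𝕜 X]

theorem exists_denseExtreme_image_eval_eq [CompleteSpace X] [SeparableSpace X]
    (hX : ¬ FiniteDimensional 𝕜 X) (K : ConvexWeakStarCompacts 𝕜 X) (s : Finset X) :
    ∃ L ∈ denseExtreme 𝕜 X, ∀ A ∈ s,
      (fun σ : WeakDual 𝕜 X => σ A) '' L.carrier = (fun σ : WeakDual 𝕜 X => σ A) '' K.carrier := by
  obtain ⟨e, he, hsep⟩ := exists_summable_norm_sq_separating 𝕜 X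
  have hstrict := WeakDual.strictConvexOn_normSqAdd he hsep
  obtain ⟨C, hC⟩ : ∃ C, ∀ σ ∈ K.carrier, WeakDual.normSqAdd e σ ≤ C := by
    obtain ⟨r, hr⟩ := K.exists_subset_dualBall
    refine ⟨r ^ 2 * (1 + ∑' k, ‖e k‖ ^ 2), fun σ hσ => (WeakDual.normSqAdd_le he σ).trans ?_⟩
    have h0 : 0 ≤ ∑' k, ‖e k‖ ^ 2 := tsum_nonneg fun _ => by positivity
    have : ‖WeakDual.toStrongDual σ‖ ≤ r := mem_closedBall_zero_iff.1 (hr hσ)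
    gcongr
  let ev : WeakDual 𝕜 X → s → 𝕜 := fun σ A => σ (A : X)
  have hev : Continuous ev := continuous_pi fun A => WeakDual.eval_continuous (A : X)
  let S : Set (WeakDual 𝕜 X) := ev ⁻¹' (ev '' K.carrier) ∩ {σ | WeakDual.normSqAdd e σ ≤ C}
  have hSclosed : IsClosed S := ((K.isCompact.image hev).isClosed.preimage hev).inter
    (WeakDual.isClosed_normSqAdd_le he C)
  have hKS : K.carrier ⊆ S := fun σ hσ => ⟨⟨σ, hσ, rfl⟩, hC σ hσ⟩
  have hScompact : IsCompact S := by
    refine (isCompact_dualBall (√C)).of_isClosed_subset hSclosed fun σ hσ => ?_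
    exact mem_closedBall_zero_iff.2
      (Real.le_sqrt_of_sq_le ((WeakDual.norm_sq_le_normSqAdd σ).trans hσ.2))
  have hSconvex : Convex ℝ S := by
    rintro σ ⟨⟨σ', hσ', h1⟩, hσ⟩ τ ⟨⟨τ', hτ', h2⟩, hτ⟩ a b ha hb hab
    refine ⟨⟨a • σ' + b • τ', K.convex hσ' hτ' ha hb hab, funext fun A => ?_⟩, ?_⟩
    · have h1 : σ' (A : X) = σ A := congrFun h1 A
      have h2 : τ' (A : X) = τ A := congrFun h2 A
      change (a • σ' + b • τ') (A : X) = (a • σ + b • τ) (A : X)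
      rw [WeakDual.comb_apply, WeakDual.comb_apply, h1, h2]
    · refine (hstrict.convexOn.2 (mem_univ _) (mem_univ _) ha hb hab).trans ?_
      exact (convex_Iic C) hσ hτ ha hb hab
  let L : ConvexWeakStarCompacts 𝕜 X := ⟨S, K.nonempty.mono hKS, hSconvex, hScompact⟩
  refine ⟨L, L.closure_extremePoints_subset.antisymm' fun σ hσ => ?_, fun A hA => ?_⟩
  · refine mem_closure_iff.2 fun O hO hσO => ?_
    obtain ⟨t, ht⟩ := WeakDual.exists_finset_forall_add_mem hO hσO
    classical
    -- Vanishing on `s` keeps the line over the joint values of `K`; vanishing on `t` keeps it in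
    -- `O`.
    obtain ⟨ζ, hζ, hζ0⟩ := exists_weakDual_ne_zero_forall_finset hX (s ∪ t)
    obtain ⟨c, hc⟩ := WeakDual.exists_normSqAdd_add_smul_eq hstrict.convexOn hζ hσ.2
    have happ (A : X) (hA : A ∈ s ∪ t) : (σ + c • ζ) A = σ A := by
      change σ A + (c • ζ) A = σ A
      rw [weakDual_real_smul_apply, hζ0 A hA, mul_zero, add_zero]
    have hmem : σ + c • ζ ∈ S := by
      refine ⟨?_, hc.le⟩
      have : ev (σ + c • ζ) = ev σ := funext fun A => happ A (Finset.mem_union_left _ A.2)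
      rw [mem_preimage, this]
      exact hσ.1
    refine ⟨σ + c • ζ, ht _ fun A hA => happ A (Finset.mem_union_right _ hA), ?_⟩
    refine mem_extremePoints_iff_left.2 ⟨hmem, fun τ hτ ρ hρ hseg => ?_⟩
    obtain ⟨a, b, ha, hb, hab, hcomb⟩ := hseg
    by_contra hne
    have hτρ : τ ≠ ρ := by
      rintro rfl
      rw [← add_smul, hab, one_smul] at hcomb
      exact hne hcomb
    -- A proper convex combination of two distinct points of `S` has level strictly below `C`.
    have := hstrict.2 (mem_univ τ) (mem_univ ρ) hτρ ha hb hab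
    rw [hcomb, hc] at this
    exact this.not_ge ((convex_Iic C) hτ.2 hρ.2 ha.le hb.le hab)
  · refine Subset.antisymm ?_ (image_mono hKS)
    rintro _ ⟨σ, ⟨⟨τ, hτ, h⟩, -⟩, rfl⟩
    exact ⟨τ, hτ, congrFun h ⟨A, hA⟩⟩

end ConvexWeakStarCompacts

theorem mainTheorem3 {𝕜 X : Type*} [RCLike 𝕜] [NormedAddCommGroup X] [NormedSpace 𝕜 X]
    [CompleteSpace X] [TopologicalSpace.SeparableSpace X] (hX : ¬ FiniteDimensional 𝕜 X) :
    Dense (ConvexWeakStarCompacts.denseExtreme 𝕜 X) ∧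
      IsGδ (ConvexWeakStarCompacts.denseExtreme 𝕜 X) :=
  ⟨ConvexWeakStarCompacts.dense_of_forall_finset
    (ConvexWeakStarCompacts.exists_denseExtreme_image_eval_eq hX),
    ConvexWeakStarCompacts.isGδ_denseExtreme⟩
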